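/- **Theorem (bivariate distribution of the fractional Poisson process).** Let $\lambda>0$ and $0<\nu\le 1$. For real $\alpha,\eta,\gamma>0$ and $z\in\mathbb{R}$ let $$E^{\gamma}_{\alpha,\eta}(z)=\sum_{j=0}^{\infty}\frac{\Gamma(\gamma+j)\,z^{j}}{j!\,\Gamma(\gamma)\,\Gamma(\alpha j+\eta)},\qquad E_{\alpha,\eta}(z)=E^{1}_{\alpha,\eta}(z),$$ be the generalised (Prabhakar) Mittag-Leffler function. Let $N^{\nu}(t)$, $t\ge 0$, be the fractional Poisson process, i.e. the renewal process $N^\nu(t)=\#\{n\ge 1: J_1+\dots+J_n\le t\}$ whose interarrival times $J_1,J_2,\dots$ are independent with common law $\Pr\{J_i\in \mathrm dx\}=\lambda x^{\nu-1}E_{\nu,\nu}(-\lambda x^{\nu})\,\mathrm dx$ on $(0,\infty)$. Then for all $0\le s\le t$ and all integers $1\le k<r$, $$\Pr\{N^{\nu}(s)=k,\,N^{\nu}(t)=r\}=\lambda^{r}\int_{0}^{s}w^{\nu k-1}E^{k}_{\nu,\nu k}(-\lambda w^{\nu})\int_{s-w}^{t-w}y^{\nu-1}E_{\nu,\nu}(-\lambda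 y^{\nu})\,(t-w-y)^{\nu(r-k-1)}E^{r-k}_{\nu,\nu(r-k-1)+1}\bigl(-\lambda(t-w-y)^{\nu}\bigr)\,\mathrm dy\,\mathrm dw,$$ where all the integrals converge absolutely. -/

import Mathlib

open MeasureTheory ProbabilityTheory

/-- The generalised (Prabhakar) Mittag-Leffler function `E^γ_{α,η}(z)` for real parameters
`α, η, γ > 0` and real argument `z`:
the sum over `j ≥ 0` of `Γ(γ + j) z^j / (j! Γ(γ) Γ(α j + η))`. -/
noncomputable def prabhakar (γ α η z : ℝ) : ℝ :=
  ∑' j : ℕ, Real.Gamma (γ + j) * z ^ j /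
    ((j.factorial : ℝ) * Real.Gamma γ * Real.Gamma (α * j + η))

/-- The two-parameter Mittag-Leffler function `E_{α,η}(z) = E^1_{α,η}(z)`. -/
noncomputable def mittagLeffler (α η z : ℝ) : ℝ :=
  prabhakar 1 α η z

/-- The Mittag-Leffler interarrival law on `(0, ∞)`, with Lebesgue density
`x ↦ lam x^(ν-1) E_{ν,ν}(-lam x^ν)`. -/
noncomputable def mittagLefflerLaw (lam ν : ℝ) : Measure ℝ :=
  (volume.restrict (Set.Ioi (0 : ℝ))).withDensity
    (fun x => ENNReal.ofReal (lam * x ^ (ν - 1) * mittagLeffler ν ν (-lam * x ^ ν)))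

/-- The instant `T_n = J_0 + ... + J_{n-1}` of the `n`-th event, for interarrival times `J`. -/
def eventTime {Ω : Type*} (J : ℕ → Ω → ℝ) (n : ℕ) (ω : Ω) : ℝ :=
  ∑ i ∈ Finset.range n, J i ω

/-- `N` (a family indexed by the times `t ≥ 0`) is a fractional Poisson process with rate `lam`
and index `ν`: the renewal counting process of independent interarrival times that all have the
Mittag-Leffler law, that is, almost surely, for every `t ≥ 0`, `N t` is the number of `n ≥ 1`
with `T_n ≤ t`. The count is taken in `ℕ∞`, so that it is finite wherever it equals `N t`. -/
def IsFractionalPoissonProcess {Ω : Type*} [MeasurableSpace Ω] (lam ν : ℝ)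
    (N : ℝ → Ω → ℕ) (P : Measure Ω) : Prop :=
  ∃ J : ℕ → Ω → ℝ,
    iIndepFun J P ∧
    (∀ n, HasLaw (J n) (mittagLefflerLaw lam ν) P) ∧
    ∀ᵐ ω ∂P, ∀ t : ℝ, 0 ≤ t →
      (N t ω : ℕ∞) = Set.encard {n : ℕ | 1 ≤ n ∧ eventTime J n ω ≤ t}

/-! Every function in the formula is a kernel `mlKernel ν p η`, that is x ↦ ∑ p_j
x^(νj+η-1)/Γ(νj+η), with p = (1 + lam X)^(-d). By the Beta integral, convolving two kernels
multiplies their power series and adds their parameters η (`mlKernel_convolution`). Hence T_n has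
density lam^n · kernel((1 + lam X)^(-n), νn). Convolving this with the survival function kernel((1 +
lam X)^(-1), 1) gives the law of the number of events up to a given time
(`measure_eventTime_le_lt`).

For the joint law, {N(s) = k, N(t) = r} is almost surely {T_k ≤ s < T_(k+1), T_r ≤ t < T_(r+1)}.
Condition on T_k = w and on the next interarrival time y. The later interarrival times are
independent of both and must produce exactly r - k - 1 events in time t - w - y (`measure_event`).

Passing between Lebesgue integrals of `ENNReal.ofReal` and signed integrals requires the
Mittag-Leffler density to be nonnegative. This is deduced from the law having total mass one: a
negative part would keep the survival function above a positive constant, and its fractional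
integral would then be unbounded (`integral_negPart_eq_zero`). Positivity also gives convergence of
the outer integral, since the corresponding Lebesgue integral is a probability. -/

/-! ### Growth of the Gamma function. -/

/-- Keep only y > A in Euler's integral and use y^x ≥ A^x there. The free parameter A lets Γ outgrow
any prescribed geometric rate. -/
theorem rpow_mul_exp_neg_le_Gamma_add_one {A x : ℝ} (hA : 0 < A) (hx : 0 < x) :
    A ^ x * Real.exp (-A) ≤ Real.Gamma (x + 1) := by
  have hint := Real.GammaIntegral_convergent (s := x + 1) (by linarith)
  rw [Real.Gamma_eq_integral (by linarith)]
  have hsub : Set.Ioi A ⊆ Set.Ioi (0 : ℝ) := Set.Ioi_subset_Ioi hA.le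
  calc A ^ x * Real.exp (-A) = ∫ y in Set.Ioi A, A ^ x * Real.exp (-y) := by
        rw [integral_const_mul, integral_exp_neg_Ioi]
    _ ≤ ∫ y in Set.Ioi A, Real.exp (-y) * y ^ (x + 1 - 1) := by
        refine setIntegral_mono_on ?_ (hint.mono_set hsub) measurableSet_Ioi fun y hy => ?_
        · exact (integrableOn_exp_neg_Ioi A).const_mul _
        · rw [mul_comm, add_sub_cancel_right]
          gcongr
          exact le_of_lt hy
    _ ≤ _ := by
        refine setIntegral_mono_set hint ?_ hsub.eventuallyLE
        filter_upwards [ae_restrict_mem measurableSet_Ioi] with y hy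
        have : (0:ℝ) < y := hy
        positivity

/-- The reciprocals of the Gamma function along an arithmetic progression decay faster than any
geometric sequence. -/
theorem exists_inv_Gamma_le_geometric {ν η ε : ℝ} (hν : 0 < ν) (hη : 0 < η) (hε : 0 < ε) :
    ∃ K : ℝ, 0 < K ∧ ∀ n : ℕ, (Real.Gamma (ν * n + η))⁻¹ ≤ K * ε ^ n := by
  -- B is chosen so that B^ν = 1/ε. The extra factor e in A = eB yields e^x ≥ x, which absorbs the x
  -- in Γ(x + 1) = x Γ(x).
  set B : ℝ := ε ^ (-(1 / ν)) with hB
  have hBpos : 0 < B := by positivity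
  have hBν : B ^ ν = ε⁻¹ := by
    rw [hB, ← Real.rpow_mul hε.le, ← Real.rpow_neg_one]
    congr 1
    field_simp
  set A : ℝ := Real.exp 1 * B with hA
  have hApos : 0 < A := by positivity
  refine ⟨Real.exp A * B ^ (-η), by positivity, fun n => ?_⟩
  set x : ℝ := ν * n + η with hx
  have hxpos : 0 < x := by positivity
  have h1 := rpow_mul_exp_neg_le_Gamma_add_one hApos hxpos
  rw [Real.Gamma_add_one hxpos.ne'] at h1
  have hG := Real.Gamma_pos_of_pos hxpos
  have h2 : B ^ x * Real.exp (-A) ≤ Real.Gamma x := by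
    have h3 : x ≤ Real.exp x := by linarith [Real.add_one_le_exp x]
    have h4 : A ^ x = Real.exp x * B ^ x := by
      rw [hA, Real.mul_rpow (Real.exp_pos 1).le hBpos.le, Real.exp_one_rpow]
    rw [h4] at h1
    have h5 : x * (B ^ x * Real.exp (-A)) ≤ x * Real.Gamma x := by
      refine le_trans ?_ h1
      rw [mul_assoc]
      gcongr
    exact le_of_mul_le_mul_left h5 hxpos
  have h6 : B ^ x = (ε ^ n)⁻¹ * B ^ η := by
    rw [hx, Real.rpow_add hBpos, Real.rpow_mul hBpos.le, hBν, Real.rpow_natCast, inv_pow]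
  have h7 : Real.exp A * B ^ (-η) * ε ^ n = (B ^ x * Real.exp (-A))⁻¹ := by
    rw [h6, Real.exp_neg, Real.rpow_neg hBpos.le]
    simp only [mul_inv, inv_inv]
    ring
  rw [h7]
  exact inv_anti₀ (by positivity) h2

/-! ### Mittag-Leffler kernels attached to power series. -/

/-- Power series whose coefficients grow at most geometrically. -/
def GeomBounded (p : PowerSeries ℝ) : Prop :=
  ∃ C R : ℝ, 0 < C ∧ 0 < R ∧ ∀ j : ℕ, |PowerSeries.coeff j p| ≤ C * R ^ j

/-- The series `∑ p_j z^j / Γ(ν j + η)`. -/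
noncomputable def mlSeries (ν : ℝ) (p : PowerSeries ℝ) (η z : ℝ) : ℝ :=
  ∑' j : ℕ, PowerSeries.coeff j p * z ^ j / Real.Gamma (ν * j + η)

/-- The function `x ↦ ∑ p_j x^(ν j + η - 1) / Γ(ν j + η)` on the positive half-line. -/
noncomputable def mlKernel (ν : ℝ) (p : PowerSeries ℝ) (η x : ℝ) : ℝ :=
  x ^ (η - 1) * mlSeries ν p η (x ^ ν)

/-- A Weierstrass majorant, uniform on |z| ≤ Z; summability and continuity both follow from it. -/
theorem GeomBounded.exists_coeff_mul_inv_Gamma_le {p : PowerSeries ℝ} (hp : GeomBounded p)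
    {ν η Z : ℝ} (hν : 0 < ν) (hη : 0 < η) :
    ∃ K : ℝ, ∀ (j : ℕ) (z : ℝ), |z| ≤ Z →
      ‖PowerSeries.coeff j p * z ^ j / Real.Gamma (ν * j + η)‖ ≤ K * (1 / 2) ^ j := by
  obtain ⟨C, R, hC, hR, hp⟩ := hp
  by_cases hZ : 0 ≤ Z
  swap
  · exact ⟨0, fun j z hz => absurd ((abs_nonneg z).trans hz) hZ⟩
  -- This ε cancels R^j (Z + 1)^j and leaves (1/2)^j; Z + 1 in place of Z avoids a zero denominator.
  obtain ⟨K, hK, hb⟩ := exists_inv_Gamma_le_geometric hν hη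
    (ε := 1 / (2 * (R * (Z + 1)))) (by positivity)
  refine ⟨C * K, fun j z hz => ?_⟩
  have hG : 0 < Real.Gamma (ν * j + η) := Real.Gamma_pos_of_pos (by positivity)
  rw [div_eq_mul_inv, norm_mul, norm_mul, norm_pow, Real.norm_eq_abs, Real.norm_eq_abs,
    Real.norm_of_nonneg (inv_nonneg.2 hG.le)]
  calc |PowerSeries.coeff j p| * |z| ^ j * (Real.Gamma (ν * j + η))⁻¹
      ≤ (C * R ^ j) * (Z + 1) ^ j * (K * (1 / (2 * (R * (Z + 1)))) ^ j) := by
        have := hp j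
        have := hb j
        gcongr
        linarith
    _ = C * K * (R * (Z + 1) * (1 / (2 * (R * (Z + 1))))) ^ j := by
        rw [mul_pow, mul_pow]; ring
    _ = _ := by
        congr 2
        field_simp

theorem GeomBounded.summable_mlSeries {p : PowerSeries ℝ} (hp : GeomBounded p)
    {ν η : ℝ} (hν : 0 < ν) (hη : 0 < η) (z : ℝ) :
    Summable fun j : ℕ => ‖PowerSeries.coeff j p * z ^ j / Real.Gamma (ν * j + η)‖ := by
  obtain ⟨K, hK⟩ := hp.exists_coeff_mul_inv_Gamma_le (Z := |z|) hν hη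
  exact Summable.of_nonneg_of_le (fun j => norm_nonneg _) (fun j => hK j z le_rfl)
    (summable_geometric_two.mul_left K)

theorem GeomBounded.continuous_mlSeries {p : PowerSeries ℝ} (hp : GeomBounded p)
    {ν η : ℝ} (hν : 0 < ν) (hη : 0 < η) : Continuous (mlSeries ν p η) := by
  rw [continuous_iff_continuousAt]
  intro z
  obtain ⟨K, hK⟩ := hp.exists_coeff_mul_inv_Gamma_le (Z := |z| + 1) hν hη
  have hc : ContinuousOn (mlSeries ν p η) (Metric.closedBall 0 (|z| + 1)) := by
    refine continuousOn_tsum (fun j => by fun_prop) (summable_geometric_two.mul_left K)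
      fun j y hy => hK j y ?_
    simpa using hy
  refine hc.continuousAt (Metric.closedBall_mem_nhds_of_mem ?_)
  simp

theorem GeomBounded.continuousOn_mlKernel {p : PowerSeries ℝ} (hp : GeomBounded p)
    {ν η : ℝ} (hν : 0 < ν) (hη : 0 < η) : ContinuousOn (mlKernel ν p η) (Set.Ioi 0) := by
  have h := hp.continuous_mlSeries hν hη
  refine ContinuousOn.mul ?_ ?_
  · exact fun x hx => (Real.continuousAt_rpow_const _ _ (Or.inl (ne_of_gt hx))).continuousWithinAt
  · exact (h.comp (Real.continuous_rpow_const hν.le)).continuousOn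

theorem GeomBounded.measurable_mlKernel {p : PowerSeries ℝ} (hp : GeomBounded p)
    {ν η : ℝ} (hν : 0 < ν) (hη : 0 < η) : Measurable (mlKernel ν p η) := by
  have h := (hp.continuous_mlSeries hν hη).measurable
  unfold mlKernel
  fun_prop

theorem mlKernel_term {ν η x c : ℝ} (hx : 0 < x) (j : ℕ) :
    x ^ (η - 1) * (c * (x ^ ν) ^ j / Real.Gamma (ν * j + η)) =
      c * (x ^ (ν * j + η - 1) / Real.Gamma (ν * j + η)) := by
  rw [← Real.rpow_natCast (x ^ ν) j, ← Real.rpow_mul hx.le, add_sub_assoc, Real.rpow_add hx]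
  ring

theorem GeomBounded.hasSum_mlKernel {p : PowerSeries ℝ} (hp : GeomBounded p)
    {ν η x : ℝ} (hν : 0 < ν) (hη : 0 < η) (hx : 0 < x) :
    HasSum (fun j : ℕ => PowerSeries.coeff j p * (x ^ (ν * j + η - 1) / Real.Gamma (ν * j + η)))
      (mlKernel ν p η x) := by
  have h := (hp.summable_mlSeries hν hη (x ^ ν)).of_norm.hasSum.mul_left (x ^ (η - 1))
  simp only [mlKernel_term hx] at h
  exact h

theorem GeomBounded.summable_norm_mlKernel {p : PowerSeries ℝ} (hp : GeomBounded p)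
    {ν η x : ℝ} (hν : 0 < ν) (hη : 0 < η) (hx : 0 < x) :
    Summable fun j : ℕ =>
      ‖PowerSeries.coeff j p * (x ^ (ν * j + η - 1) / Real.Gamma (ν * j + η))‖ := by
  have h := (hp.summable_mlSeries hν hη (x ^ ν)).mul_left ‖x ^ (η - 1)‖
  simpa only [← norm_mul, mlKernel_term hx] using h

/-! ### Convolution of kernels. -/

/-- The Beta integral: the functions `x ^ (a - 1) / Γ(a)` form a convolution semigroup. -/
theorem integral_rpow_div_Gamma_mul {a b x : ℝ} (ha : 0 < a) (hb : 0 < b) (hx : 0 < x) :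
    ∫ y in (0 : ℝ)..x, y ^ (a - 1) / Real.Gamma a * ((x - y) ^ (b - 1) / Real.Gamma b) =
      x ^ (a + b - 1) / Real.Gamma (a + b) := by
  have hGa := Real.Gamma_pos_of_pos ha
  have hGb := Real.Gamma_pos_of_pos hb
  have hGab := Real.Gamma_pos_of_pos (add_pos ha hb)
  have h : ∫ y in (0 : ℝ)..x, y ^ (a - 1) * (x - y) ^ (b - 1) =
      x ^ (a + b - 1) * beta a b := by
    apply Complex.ofReal_injective
    rw [← intervalIntegral.integral_ofReal]
    have h1 := Complex.betaIntegral_scaled a b hx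
    have h2 : Complex.betaIntegral a b = ((beta a b : ℝ) : ℂ) := by
      rw [Complex.betaIntegral_eq_Gamma_mul_div _ _ (by simpa) (by simpa), beta,
        ← Complex.ofReal_add, Complex.Gamma_ofReal, Complex.Gamma_ofReal, Complex.Gamma_ofReal]
      push_cast; rfl
    rw [h2] at h1
    rw [Complex.ofReal_mul, Complex.ofReal_cpow hx.le]
    push_cast
    rw [← h1]
    refine intervalIntegral.integral_congr fun y hy => ?_
    rw [Set.uIcc_of_le hx.le] at hy
    rw [Complex.ofReal_cpow hy.1, Complex.ofReal_cpow (sub_nonneg.2 hy.2)]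
    push_cast; rfl
  calc _ = ∫ y in (0 : ℝ)..x, (Real.Gamma a * Real.Gamma b)⁻¹ *
        (y ^ (a - 1) * (x - y) ^ (b - 1)) := by
        refine intervalIntegral.integral_congr fun y _ => ?_
        field_simp
    _ = _ := by
        rw [intervalIntegral.integral_const_mul, h, beta]
        field_simp

theorem intervalIntegrable_rpow_div_Gamma_mul {a b x : ℝ} (ha : 0 < a) (hb : 0 < b)
    (hx : 0 < x) : IntervalIntegrable
      (fun y => y ^ (a - 1) / Real.Gamma a * ((x - y) ^ (b - 1) / Real.Gamma b)) volume 0 x := by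
  have hG := Real.Gamma_pos_of_pos (add_pos ha hb)
  -- A non-integrable function has integral 0 by convention, so the nonzero Beta value already
  -- proves integrability.
  refine intervalIntegral.intervalIntegrable_of_integral_ne_zero ?_
  rw [integral_rpow_div_Gamma_mul ha hb hx]
  positivity

theorem mlKernel_eq_tsum (p : PowerSeries ℝ) {ν η x : ℝ} (hx : 0 < x) :
    mlKernel ν p η x =
      ∑' j : ℕ, PowerSeries.coeff j p * (x ^ (ν * j + η - 1) / Real.Gamma (ν * j + η)) := by
  simp only [mlKernel, mlSeries, ← tsum_mul_left, mlKernel_term hx]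

/-- Cauchy product: h depends only on i + j, so summing along antidiagonals collects the
coefficients of p * q. -/
theorem tsum_prod_coeff_mul {p q : PowerSeries ℝ} {h : ℕ → ℝ}
    (hs : Summable fun ij : ℕ × ℕ =>
      PowerSeries.coeff ij.1 p * PowerSeries.coeff ij.2 q * h (ij.1 + ij.2)) :
    ∑' ij : ℕ × ℕ, PowerSeries.coeff ij.1 p * PowerSeries.coeff ij.2 q * h (ij.1 + ij.2) =
      ∑' n : ℕ, PowerSeries.coeff n (p * q) * h n := by
  have hs' := Finset.HasAntidiagonal.sigmaAntidiagonalEquivProd.summable_iff.2 hs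
  rw [← Finset.HasAntidiagonal.sigmaAntidiagonalEquivProd.tsum_eq (_ : ℕ × ℕ → ℝ)]
  refine (hs'.tsum_sigma' fun n => (hasSum_fintype _).summable).trans (tsum_congr fun n => ?_)
  rw [tsum_fintype, PowerSeries.coeff_mul, Finset.sum_mul,
    ← Finset.sum_coe_sort (Finset.HasAntidiagonal.antidiagonal n)]
  refine Finset.sum_congr rfl fun ij _ => ?_
  have := Finset.HasAntidiagonal.mem_antidiagonal.1 ij.2
  simp [← this]

theorem integrable_tsum_of_summable_integral_norm {α ι : Type*} [MeasurableSpace α]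
    {μ : Measure α} [Countable ι] {F : ι → α → ℝ} {f : α → ℝ} (hF : ∀ i, Integrable (F i) μ)
    (hsum : Summable fun i => ∫ a, ‖F i a‖ ∂μ) (hf : AEStronglyMeasurable f μ)
    (hFf : ∀ᵐ a ∂μ, HasSum (fun i => F i a) (f a)) : Integrable f μ := by
  refine ⟨hf, ?_⟩
  have h1 : ∀ᵐ a ∂μ, ‖f a‖ₑ ≤ ∑' i, ‖F i a‖ₑ := by
    filter_upwards [hFf] with a ha
    rw [← ha.tsum_eq]
    exact enorm_tsum_le_tsum_enorm
  refine (lintegral_mono_ae h1).trans_lt ?_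
  rw [lintegral_tsum fun i => (hF i).1.enorm]
  simp_rw [← ofReal_integral_norm_eq_lintegral_enorm (hF _)]
  rw [← ENNReal.ofReal_tsum_of_nonneg (fun i => integral_nonneg fun a => norm_nonneg _) hsum]
  exact ENNReal.ofReal_lt_top

/-- Convolution of two kernels corresponds to the product of their power series. -/
theorem mlKernel_convolution {p q : PowerSeries ℝ} (hp : GeomBounded p) (hq : GeomBounded q)
    {ν η₁ η₂ x : ℝ} (hν : 0 < ν) (h₁ : 0 < η₁) (h₂ : 0 < η₂) (hx : 0 < x) :
    IntervalIntegrable (fun y => mlKernel ν p η₁ y * mlKernel ν q η₂ (x - y)) volume 0 x ∧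
      ∫ y in (0 : ℝ)..x, mlKernel ν p η₁ y * mlKernel ν q η₂ (x - y) =
        mlKernel ν (p * q) (η₁ + η₂) x := by
  set h : ℕ → ℝ := fun n =>
    x ^ (ν * n + (η₁ + η₂) - 1) / Real.Gamma (ν * n + (η₁ + η₂)) with hh
  set φ : ℕ × ℕ → ℝ → ℝ := fun ij y =>
    y ^ (ν * ij.1 + η₁ - 1) / Real.Gamma (ν * ij.1 + η₁) *
      ((x - y) ^ (ν * ij.2 + η₂ - 1) / Real.Gamma (ν * ij.2 + η₂)) with hφ
  set F : ℕ × ℕ → ℝ → ℝ := fun ij y =>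
    PowerSeries.coeff ij.1 p * PowerSeries.coeff ij.2 q * φ ij y with hF
  set μ : Measure ℝ := volume.restrict (Set.Ioo 0 x) with hμ
  have hpos : ∀ (η : ℝ), 0 < η → ∀ n : ℕ, 0 < ν * n + η := fun η hη n => by positivity
  have hφint : ∀ ij, Integrable (φ ij) μ := fun ij =>
    ((intervalIntegrable_iff_integrableOn_Ioo_of_le hx.le).1
      (intervalIntegrable_rpow_div_Gamma_mul (hpos _ h₁ ij.1) (hpos _ h₂ ij.2) hx))
  have hφval : ∀ ij, ∫ y, φ ij y ∂μ = h (ij.1 + ij.2) := fun ij => by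
    rw [hμ, ← integral_Ioc_eq_integral_Ioo, ← intervalIntegral.integral_of_le hx.le, hφ,
      integral_rpow_div_Gamma_mul (hpos _ h₁ ij.1) (hpos _ h₂ ij.2) hx]
    simp only [hh]
    push_cast
    congr 2 <;> ring
  have hnn : ∀ ij, ∀ y ∈ Set.Ioo 0 x, 0 ≤ φ ij y := fun ij y hy => by
    have e1 := hy.1
    have e2 := sub_pos.2 hy.2
    have e3 := Real.Gamma_pos_of_pos (hpos _ h₁ ij.1)
    have e4 := Real.Gamma_pos_of_pos (hpos _ h₂ ij.2)
    simp only [hφ]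
    positivity
  -- Since `φ` is nonnegative, the Beta integral evaluates the L¹ norms exactly, and exchanging sum
  -- and integral reduces to a numerical series.
  have hnorm : ∀ ij, ∫ y, ‖F ij y‖ ∂μ =
      |PowerSeries.coeff ij.1 p| * |PowerSeries.coeff ij.2 q| * h (ij.1 + ij.2) := fun ij => by
    rw [← hφval, ← integral_const_mul]
    refine setIntegral_congr_fun measurableSet_Ioo fun y hy => ?_
    simp only [hF, norm_mul, Real.norm_eq_abs, abs_of_nonneg (hnn ij y hy)]
  have hsum : Summable fun ij => ∫ y, ‖F ij y‖ ∂μ := by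
    simp_rw [hnorm]
    obtain ⟨C, R, hC, hR, hp⟩ := hp
    obtain ⟨D, S, hD, hS, hq⟩ := hq
    have hxν : 0 < x ^ ν := by positivity
    -- R + S bounds both growth rates; this ε cancels ((R + S) x^ν)^(i+j) and leaves (1/2)^(i+j).
    obtain ⟨K, hK, hb⟩ := exists_inv_Gamma_le_geometric hν (add_pos h₁ h₂)
      (ε := 1 / (2 * (R + S) * x ^ ν)) (by positivity)
    have hg : Summable fun ij : ℕ × ℕ => (1 / 2 : ℝ) ^ ij.1 * (1 / 2 : ℝ) ^ ij.2 :=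
      summable_geometric_two.mul_of_nonneg summable_geometric_two
        (fun _ => by positivity) (fun _ => by positivity)
    refine Summable.of_nonneg_of_le (fun ij => ?_) (fun ij => ?_)
      (hg.mul_left (C * D * K * x ^ (η₁ + η₂ - 1)))
    · have := Real.Gamma_pos_of_pos (hpos _ (add_pos h₁ h₂) (ij.1 + ij.2))
      simp only [hh]
      positivity
    · obtain ⟨i, j⟩ := ij
      have hG := Real.Gamma_pos_of_pos (hpos _ (add_pos h₁ h₂) (i + j))
      have e1 : |PowerSeries.coeff i p| ≤ C * (R + S) ^ i :=
        (hp i).trans (by gcongr; linarith)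
      have e2 : |PowerSeries.coeff j q| ≤ D * (R + S) ^ j :=
        (hq j).trans (by gcongr; linarith)
      have e3 : h (i + j) ≤ x ^ (η₁ + η₂ - 1) * (x ^ ν) ^ (i + j) *
          (K * (1 / (2 * (R + S) * x ^ ν)) ^ (i + j)) := by
        simp only [hh]
        rw [add_sub_assoc, Real.rpow_add hx, Real.rpow_mul hx.le, Real.rpow_natCast,
          div_eq_mul_inv, mul_comm ((x ^ ν) ^ (i + j))]
        have := hb (i + j)
        gcongr
      have e4 : 0 ≤ h (i + j) := by simp only [hh]; positivity
      calc _ ≤ C * (R + S) ^ i * (D * (R + S) ^ j) * (x ^ (η₁ + η₂ - 1) * (x ^ ν) ^ (i + j) *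
          (K * (1 / (2 * (R + S) * x ^ ν)) ^ (i + j))) := by
            gcongr
        _ = C * D * K * x ^ (η₁ + η₂ - 1) *
            ((R + S) * x ^ ν * (1 / (2 * (R + S) * x ^ ν))) ^ (i + j) := by
            rw [mul_pow, mul_pow, pow_add (R + S)]; ring
        _ = _ := by
            rw [← pow_add]
            congr 2
            field_simp
  have hFint : ∀ ij, Integrable (F ij) μ := fun ij => (hφint ij).const_mul _
  have hHas : ∀ᵐ y ∂μ, HasSum (fun ij => F ij y)
      (mlKernel ν p η₁ y * mlKernel ν q η₂ (x - y)) := by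
    filter_upwards [ae_restrict_mem measurableSet_Ioo] with y hy
    have hy2 := sub_pos.2 hy.2
    have := (hp.hasSum_mlKernel hν h₁ hy.1).mul (hq.hasSum_mlKernel hν h₂ hy2)
      (summable_mul_of_summable_norm (hp.summable_norm_mlKernel hν h₁ hy.1)
        (hq.summable_norm_mlKernel hν h₂ hy2))
    have hfun : (fun ij => F ij y) = fun ij : ℕ × ℕ =>
        PowerSeries.coeff ij.1 p * (y ^ (ν * ij.1 + η₁ - 1) / Real.Gamma (ν * ij.1 + η₁)) *
        (PowerSeries.coeff ij.2 q *
          ((x - y) ^ (ν * ij.2 + η₂ - 1) / Real.Gamma (ν * ij.2 + η₂))) := by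
      funext ij
      simp only [hF, hφ]
      ring
    rw [hfun]
    exact this
  have hmeas : Measurable fun y => mlKernel ν p η₁ y * mlKernel ν q η₂ (x - y) :=
    (hp.measurable_mlKernel hν h₁).mul
      ((hq.measurable_mlKernel hν h₂).comp (measurable_const.sub measurable_id))
  have hint := integrable_tsum_of_summable_integral_norm hFint hsum
    hmeas.aestronglyMeasurable hHas
  refine ⟨(intervalIntegrable_iff_integrableOn_Ioo_of_le hx.le).2 hint, ?_⟩
  have hFval : ∀ ij, ∫ y, F ij y ∂μ =
      PowerSeries.coeff ij.1 p * PowerSeries.coeff ij.2 q * h (ij.1 + ij.2) := fun ij => by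
    rw [← hφval, ← integral_const_mul]
  have hmain := hasSum_integral_of_summable_integral_norm hFint hsum
  simp_rw [hFval] at hmain
  rw [intervalIntegral.integral_of_le hx.le, integral_Ioc_eq_integral_Ioo, mlKernel_eq_tsum _ hx,
    ← tsum_prod_coeff_mul (h := h) hmain.summable, hmain.tsum_eq]
  exact integral_congr_ae (hHas.mono fun y hy => hy.tsum_eq.symm)

theorem geomBounded_one : GeomBounded 1 := by
  refine ⟨1, 1, one_pos, one_pos, fun j => ?_⟩
  rw [PowerSeries.coeff_one]
  split_ifs <;> simp

/-- The unit series gives the kernel of fractional integration of order η; at η = 1 it is the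
constant 1, so convolving with it is ordinary integration. -/
theorem mlKernel_one {ν η x : ℝ} :
    mlKernel ν 1 η x = x ^ (η - 1) / Real.Gamma η := by
  have : mlSeries ν 1 η (x ^ ν) = 1 / Real.Gamma η := by
    rw [mlSeries, tsum_eq_single 0 fun j hj => by simp [PowerSeries.coeff_one, hj]]
    simp
  rw [mlKernel, this, mul_one_div]

/-! ### Prabhakar functions as kernels of negative binomial series. -/

/-- The power series `(1 + lam X) ^ (-d)`. -/
noncomputable def negBinomialSeries (lam : ℝ) (d : ℕ) : PowerSeries ℝ :=
  PowerSeries.rescale (-lam) (PowerSeries.mk 1) ^ d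

theorem coeff_negBinomialSeries_succ (lam : ℝ) (d j : ℕ) :
    PowerSeries.coeff j (negBinomialSeries lam (d + 1)) = (-lam) ^ j * ((d + j).choose d : ℝ) := by
  rw [negBinomialSeries, ← map_pow, PowerSeries.mk_one_pow_eq_mk_choose_add]
  simp [PowerSeries.coeff_rescale]

theorem negBinomialSeries_mul (lam : ℝ) (d e : ℕ) :
    negBinomialSeries lam d * negBinomialSeries lam e = negBinomialSeries lam (d + e) :=
  (pow_add _ _ _).symm

theorem geomBounded_negBinomialSeries {lam : ℝ} (hlam : 0 < lam) (d : ℕ) :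
    GeomBounded (negBinomialSeries lam d) := by
  cases d with
  | zero => simpa [negBinomialSeries] using geomBounded_one
  | succ d =>
    refine ⟨2 ^ d, 2 * lam, by positivity, by positivity, fun j => ?_⟩
    rw [coeff_negBinomialSeries_succ, abs_mul, abs_pow, abs_neg, abs_of_pos hlam, Nat.abs_cast]
    have : ((d + j).choose d : ℝ) ≤ 2 ^ (d + j) := by
      exact_mod_cast Nat.choose_le_two_pow _ _
    calc lam ^ j * ((d + j).choose d : ℝ) ≤ lam ^ j * 2 ^ (d + j) := by gcongr
      _ = _ := by rw [mul_pow, pow_add]; ring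

/-- For γ = d + 1 the ratio Γ(γ + j)/(j! Γ(γ)) is the binomial coefficient (d + j choose d), the
coefficient in the negative binomial expansion. -/
theorem prabhakar_eq_mlSeries (lam ν η u : ℝ) (d : ℕ) :
    prabhakar ((d : ℝ) + 1) ν η (-lam * u) =
      mlSeries ν (negBinomialSeries lam (d + 1)) η u := by
  refine tsum_congr fun j => ?_
  rw [coeff_negBinomialSeries_succ, Real.Gamma_nat_eq_factorial]
  have h : (d : ℝ) + 1 + j = ((d + j : ℕ) : ℝ) + 1 := by push_cast; ring
  rw [h, Real.Gamma_nat_eq_factorial, Nat.cast_add_choose, mul_pow]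
  have h1 : (d.factorial : ℝ) ≠ 0 := by positivity
  have h2 : (j.factorial : ℝ) ≠ 0 := by positivity
  by_cases hG : Real.Gamma (ν * j + η) = 0
  · simp [hG]
  · field_simp

theorem rpow_mul_prabhakar {lam ν η x : ℝ} {d : ℕ} (hd : 1 ≤ d) :
    x ^ (η - 1) * prabhakar d ν η (-lam * x ^ ν) =
      mlKernel ν (negBinomialSeries lam d) η x := by
  obtain ⟨d, rfl⟩ := Nat.exists_eq_add_of_le' hd
  push_cast
  rw [prabhakar_eq_mlSeries, mlKernel]

theorem rpow_mul_mittagLeffler {lam ν η x : ℝ} :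
    x ^ (η - 1) * mittagLeffler ν η (-lam * x ^ ν) =
      mlKernel ν (negBinomialSeries lam 1) η x := by
  have := rpow_mul_prabhakar (lam := lam) (ν := ν) (η := η) (x := x) (d := 1) le_rfl
  rwa [Nat.cast_one] at this

/-- The survival function `E_{ν,1}(-lam x^ν)` and the integrated density add up to one. -/
theorem mlKernel_negBinomialSeries_one_add {lam ν x : ℝ} (hlam : 0 < lam) (hν : 0 < ν)
    (hx : 0 < x) :
    mlKernel ν (negBinomialSeries lam 1) 1 x +
      lam * mlKernel ν (negBinomialSeries lam 1) (1 + ν) x = 1 := by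
  have hb := geomBounded_negBinomialSeries hlam 1
  have h1 := hb.hasSum_mlKernel hν one_pos hx
  have h2 := (hb.hasSum_mlKernel (η := 1 + ν) hν (by positivity) hx).mul_left lam
  -- After removing the constant term 1, term n + 1 of the first series cancels term n of the
  -- second.
  have h3 := (hasSum_nat_add_iff' 1).2 h1
  have h4 := h3.add h2
  have h5 : (fun n : ℕ => PowerSeries.coeff (n + 1) (negBinomialSeries lam 1) *
      (x ^ (ν * ((n + 1 : ℕ) : ℝ) + 1 - 1) / Real.Gamma (ν * ((n + 1 : ℕ) : ℝ) + 1)) +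
      lam * (PowerSeries.coeff n (negBinomialSeries lam 1) *
      (x ^ (ν * n + (1 + ν) - 1) / Real.Gamma (ν * n + (1 + ν))))) = fun _ => 0 := by
    funext n
    have e : ν * ((n + 1 : ℕ) : ℝ) + 1 = ν * n + (1 + ν) := by push_cast; ring
    rw [e, coeff_negBinomialSeries_succ, coeff_negBinomialSeries_succ, pow_succ]
    simp
    ring
  rw [h5] at h4
  have h6 := h4.unique hasSum_zero
  simp only [Finset.sum_range_one] at h6
  rw [coeff_negBinomialSeries_succ] at h6
  simp at h6
  linarith

theorem integral_mlKernel {p : PowerSeries ℝ} (hp : GeomBounded p) {ν η x : ℝ} (hν : 0 < ν)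
    (hη : 0 < η) (hx : 0 < x) :
    IntervalIntegrable (mlKernel ν p η) volume 0 x ∧
      ∫ y in (0 : ℝ)..x, mlKernel ν p η y = mlKernel ν p (η + 1) x := by
  simpa [mlKernel_one] using mlKernel_convolution hp geomBounded_one hν hη one_pos hx

theorem mittagLefflerLaw_eq (lam ν : ℝ) :
    mittagLefflerLaw lam ν = (volume.restrict (Set.Ioi (0 : ℝ))).withDensity
      (fun x => ENNReal.ofReal (lam * mlKernel ν (negBinomialSeries lam 1) ν x)) := by
  simp only [mittagLefflerLaw, mul_assoc, rpow_mul_mittagLeffler]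

/-! ### Nonnegativity of the Mittag-Leffler density from total mass one. -/

section Positivity

variable {lam ν : ℝ} (hlam : 0 < lam) (hν : 0 < ν)
  [hprob : IsProbabilityMeasure (mittagLefflerLaw lam ν)]

include hlam hν hprob

/-- `ENNReal.ofReal` discards negative values, so total mass one only says ∫ D⁺ = 1 for the signed
density D. The survival function is 1 - ∫₀ˣ D = 1 - ∫₀ˣ D⁺ + ∫₀ˣ D⁻, hence at least ∫₀ˣ D⁻. -/
theorem integral_negPart_le_survival {x₀ x : ℝ} (hx₀ : 0 < x₀) (hx : x₀ ≤ x) :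
    ∫ y in Set.Ioo 0 x₀, max (-(lam * mlKernel ν (negBinomialSeries lam 1) ν y)) 0 ≤
      mlKernel ν (negBinomialSeries lam 1) 1 x := by
  have hb := geomBounded_negBinomialSeries hlam 1
  have hx' : 0 < x := hx₀.trans_le hx
  set D : ℝ → ℝ := fun y => lam * mlKernel ν (negBinomialSeries lam 1) ν y with hD
  obtain ⟨hi, hI⟩ := integral_mlKernel hb hν hν hx'
  have hDint : IntegrableOn D (Set.Ioo 0 x) :=
    ((intervalIntegrable_iff_integrableOn_Ioo_of_le hx'.le).1 hi).const_mul lam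
  have hDval : ∫ y in Set.Ioo 0 x, D y = 1 - mlKernel ν (negBinomialSeries lam 1) 1 x := by
    rw [← integral_Ioc_eq_integral_Ioo, ← intervalIntegral.integral_of_le hx'.le,
      intervalIntegral.integral_const_mul, hI, add_comm ν 1]
    linarith [mlKernel_negBinomialSeries_one_add hlam hν hx']
  have hpos : ∫ y in Set.Ioo 0 x, max (D y) 0 ≤ 1 := by
    have hnn : 0 ≤ᵐ[volume.restrict (Set.Ioo 0 x)] fun y => max (D y) 0 :=
      Filter.Eventually.of_forall fun y => le_max_right _ _
    rw [integral_eq_lintegral_of_nonneg_ae hnn hDint.pos_part.1]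
    refine ENNReal.toReal_le_of_le_ofReal zero_le_one ?_
    rw [ENNReal.ofReal_one, ← hprob.measure_univ, mittagLefflerLaw_eq,
      withDensity_apply _ MeasurableSet.univ, Measure.restrict_univ]
    calc ∫⁻ y in Set.Ioo 0 x, ENNReal.ofReal (max (D y) 0)
        ≤ ∫⁻ y in Set.Ioi 0, ENNReal.ofReal (max (D y) 0) :=
          lintegral_mono_set Set.Ioo_subset_Ioi_self
      _ = _ := by simp [hD, ENNReal.ofReal_max]
  have hsplit : ∫ y in Set.Ioo 0 x, D y =
      (∫ y in Set.Ioo 0 x, max (D y) 0) - ∫ y in Set.Ioo 0 x, max (-D y) 0 := by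
    rw [← integral_sub hDint.pos_part hDint.neg_part]
    refine integral_congr_ae (Filter.Eventually.of_forall fun y => ?_)
    rcases le_total 0 (D y) with h | h <;> simp [h]
  have hmono : ∫ y in Set.Ioo 0 x₀, max (-D y) 0 ≤ ∫ y in Set.Ioo 0 x, max (-D y) 0 :=
    setIntegral_mono_set hDint.neg_part
      (Filter.Eventually.of_forall fun y => le_max_right _ _)
      (Set.Ioo_subset_Ioo_right hx).eventuallyLE
  linarith

theorem survival_nonneg {x : ℝ} (hx : 0 < x) :
    0 ≤ mlKernel ν (negBinomialSeries lam 1) 1 x :=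
  (integral_nonneg fun _ => le_max_right _ _).trans
    (integral_negPart_le_survival hlam hν hx le_rfl)

/-- If the Mittag-Leffler density had a negative part, the survival function would stay away from
zero, which its Volterra equation forbids. -/
theorem integral_negPart_eq_zero {x₀ : ℝ} (hx₀ : 0 < x₀) :
    ∫ y in Set.Ioo 0 x₀, max (-(lam * mlKernel ν (negBinomialSeries lam 1) ν y)) 0 = 0 := by
  have hb := geomBounded_negBinomialSeries hlam 1
  set c := ∫ y in Set.Ioo 0 x₀, max (-(lam * mlKernel ν (negBinomialSeries lam 1) ν y)) 0 with hc
  have hc0 : 0 ≤ c := integral_nonneg fun _ => le_max_right _ _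
  by_contra hne
  have hcpos : 0 < c := lt_of_le_of_ne hc0 (Ne.symm hne)
  have hG := Real.Gamma_pos_of_pos hν
  -- The survival function S satisfies (y^(ν-1)/Γ(ν)) * S = (1 - S)/lam ≤ 1/lam, where * is
  -- convolution. As S ≥ c beyond x₀, the left side at u + x₀ is at least c ∫₀ᵘ y^(ν-1)/Γ(ν) dy.
  have key : ∀ u : ℝ, 0 < u → c * (u ^ ν / ν / Real.Gamma ν) ≤ lam⁻¹ := fun u hu => by
    have hx : 0 < u + x₀ := by positivity
    obtain ⟨hi, hI⟩ := mlKernel_convolution geomBounded_one hb hν hν one_pos hx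
    rw [one_mul, intervalIntegral.integral_of_le hx.le, add_comm ν 1,
      integral_Ioc_eq_integral_Ioo] at hI
    rw [intervalIntegrable_iff_integrableOn_Ioo_of_le hx.le] at hi
    have h1 := mlKernel_negBinomialSeries_one_add hlam hν hx
    have h2 := survival_nonneg hlam hν hx
    have h3 : mlKernel ν (negBinomialSeries lam 1) (1 + ν) (u + x₀) ≤ lam⁻¹ := by
      rw [← one_div, le_div_iff₀ hlam]
      linarith
    refine le_trans ?_ (hI.trans_le h3)
    have h4 : c * (u ^ ν / ν / Real.Gamma ν) =
        ∫ y in Set.Ioo 0 u, mlKernel ν 1 ν y * c := by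
      simp only [mlKernel_one]
      rw [← integral_Ioc_eq_integral_Ioo, ← intervalIntegral.integral_of_le hu.le,
        intervalIntegral.integral_mul_const, intervalIntegral.integral_div,
        integral_rpow (Or.inl (by linarith))]
      simp [hν.ne']
      ring
    have hsub : Set.Ioo 0 u ⊆ Set.Ioo 0 (u + x₀) := Set.Ioo_subset_Ioo_right (by linarith)
    have hnn : ∀ y ∈ Set.Ioi (0 : ℝ), 0 ≤ mlKernel ν 1 ν y := fun y hy => by
      have : (0 : ℝ) < y := hy
      rw [mlKernel_one]
      positivity
    rw [h4]
    calc ∫ y in Set.Ioo 0 u, mlKernel ν 1 ν y * c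
        ≤ ∫ y in Set.Ioo 0 u, mlKernel ν 1 ν y *
            mlKernel ν (negBinomialSeries lam 1) 1 (u + x₀ - y) := by
          refine setIntegral_mono_on ?_ (hi.mono_set hsub) measurableSet_Ioo fun y hy => ?_
          · exact ((intervalIntegrable_iff_integrableOn_Ioo_of_le hu.le).1
              (integral_mlKernel geomBounded_one hν hν hu).1).mul_const c
          · have := hnn y hy.1
            gcongr
            exact integral_negPart_le_survival hlam hν hx₀ (by linarith [hy.2])
      _ ≤ _ := by
          refine setIntegral_mono_set hi ?_ hsub.eventuallyLE
          filter_upwards [ae_restrict_mem measurableSet_Ioo] with y hy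
          exact mul_nonneg (hnn y hy.1) (survival_nonneg hlam hν (sub_pos.2 hy.2))
  -- At u^ν = M the lower bound in `key` would equal 1/lam; taking u^ν = M + 1 exceeds it.
  set M := lam⁻¹ * (ν * Real.Gamma ν) / c with hM
  have hMpos : 0 < M := by positivity
  have := key ((M + 1) ^ (1 / ν)) (by positivity)
  rw [← Real.rpow_mul (by positivity), one_div_mul_cancel hν.ne', Real.rpow_one] at this
  have h5 : c * ((M + 1) / ν / Real.Gamma ν) = lam⁻¹ + c / (ν * Real.Gamma ν) := by
    rw [hM]
    field_simp
  have h6 : 0 < c / (ν * Real.Gamma ν) := by positivity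
  linarith

/-- The negative part vanishes almost everywhere on (0, x + 1), and continuity upgrades this to
every point. -/
theorem mittagLeffler_density_nonneg {x : ℝ} (hx : 0 < x) :
    0 ≤ mlKernel ν (negBinomialSeries lam 1) ν x := by
  have hb := geomBounded_negBinomialSeries hlam 1
  have hcont : ContinuousOn
      (fun y => max (-(lam * mlKernel ν (negBinomialSeries lam 1) ν y)) 0)
      (Set.Ioo 0 (x + 1)) :=
    ContinuousOn.sup
      (((hb.continuousOn_mlKernel hν hν).mono Set.Ioo_subset_Ioi_self).const_mul lam).neg
      continuousOn_const
  have hi := ((intervalIntegrable_iff_integrableOn_Ioo_of_le (by linarith)).1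
    (integral_mlKernel hb hν hν (x := x + 1) (by linarith)).1).const_mul lam
  have h0 := (setIntegral_eq_zero_iff_of_nonneg_ae
    (Filter.Eventually.of_forall fun y => le_max_right _ _) hi.neg_part).1
    (integral_negPart_eq_zero hlam hν (x₀ := x + 1) (by linarith))
  have h1 := Measure.eqOn_open_of_ae_eq h0 isOpen_Ioo hcont continuousOn_const
    ⟨hx, lt_add_one x⟩
  have h2 : -(lam * mlKernel ν (negBinomialSeries lam 1) ν x) ≤ 0 := by
    have := le_max_left (-(lam * mlKernel ν (negBinomialSeries lam 1) ν x)) 0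
    simp only [Pi.zero_apply] at h1
    linarith
  exact nonneg_of_mul_nonneg_right (by linarith) hlam

theorem mlKernel_negBinomialSeries_nonneg (n : ℕ) {x : ℝ} (hx : 0 < x) :
    0 ≤ mlKernel ν (negBinomialSeries lam (n + 1)) (ν * (n + 1 : ℕ)) x := by
  induction n generalizing x with
  | zero => simpa using mittagLeffler_density_nonneg hlam hν hx
  | succ n ih =>
    have h := (mlKernel_convolution (geomBounded_negBinomialSeries hlam (n + 1))
      (geomBounded_negBinomialSeries hlam 1) (η₁ := ν * (n + 1 : ℕ)) (η₂ := ν) hν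
      (by positivity) hν hx).2
    rw [negBinomialSeries_mul] at h
    have e : ν * (n + 1 : ℕ) + ν = ν * (n + 1 + 1 : ℕ) := by push_cast; ring
    rw [← e, ← h, intervalIntegral.integral_of_le hx.le, integral_Ioc_eq_integral_Ioo]
    exact setIntegral_nonneg measurableSet_Ioo fun y hy =>
      mul_nonneg (ih hy.1) (mittagLeffler_density_nonneg hlam hν (sub_pos.2 hy.2))

theorem mlKernel_negBinomialSeries_tail_nonneg (m : ℕ) {x : ℝ} (hx : 0 < x) :
    0 ≤ mlKernel ν (negBinomialSeries lam (m + 1)) (ν * m + 1) x := by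
  cases m with
  | zero => simpa using survival_nonneg hlam hν hx
  | succ n =>
    have h := (mlKernel_convolution (geomBounded_negBinomialSeries hlam (n + 1))
      (geomBounded_negBinomialSeries hlam 1) (η₁ := ν * (n + 1 : ℕ)) (η₂ := 1) hν
      (by positivity) one_pos hx).2
    rw [negBinomialSeries_mul] at h
    rw [← h, intervalIntegral.integral_of_le hx.le, integral_Ioc_eq_integral_Ioo]
    exact setIntegral_nonneg measurableSet_Ioo fun y hy =>
      mul_nonneg (mlKernel_negBinomialSeries_nonneg hlam hν n hy.1)
        (survival_nonneg hlam hν (sub_pos.2 hy.2))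

end Positivity

/-! ### Laws of the event times and of the number of events. -/

/-- The density, extended by zero to the negative half-line, of the `n`-th event time. -/
noncomputable def eventTimeDensity (lam ν : ℝ) (n : ℕ) : ℝ → ENNReal :=
  (Set.Ioi (0 : ℝ)).indicator fun x =>
    ENNReal.ofReal (lam ^ n * mlKernel ν (negBinomialSeries lam n) (ν * n) x)

theorem mittagLefflerLaw_eq_withDensity_eventTimeDensity (lam ν : ℝ) :
    mittagLefflerLaw lam ν = volume.withDensity (eventTimeDensity lam ν 1) := by
  rw [eventTimeDensity, withDensity_indicator measurableSet_Ioi, mittagLefflerLaw_eq]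
  simp

theorem measurable_eventTimeDensity {lam ν : ℝ} (hlam : 0 < lam) (hν : 0 < ν) {n : ℕ}
    (hn : 1 ≤ n) : Measurable (eventTimeDensity lam ν n) := by
  have hn' : (0 : ℝ) < n := by exact_mod_cast hn
  exact (((geomBounded_negBinomialSeries hlam n).measurable_mlKernel hν
    (by positivity)).const_mul _).ennreal_ofReal.indicator measurableSet_Ioi

theorem lintegral_mlKernel_convolution {p q : PowerSeries ℝ} (hp : GeomBounded p)
    (hq : GeomBounded q) {ν η₁ η₂ a b x : ℝ} (hν : 0 < ν) (h₁ : 0 < η₁) (h₂ : 0 < η₂)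
    (ha : 0 ≤ a) (hb : 0 ≤ b) (hx : 0 < x) (hp0 : ∀ y, 0 < y → 0 ≤ mlKernel ν p η₁ y)
    (hq0 : ∀ y, 0 < y → 0 ≤ mlKernel ν q η₂ y) :
    ∫⁻ y in Set.Ioo 0 x, ENNReal.ofReal (a * mlKernel ν p η₁ y) *
        ENNReal.ofReal (b * mlKernel ν q η₂ (x - y)) =
      ENNReal.ofReal (a * b * mlKernel ν (p * q) (η₁ + η₂) x) := by
  obtain ⟨hi, hI⟩ := mlKernel_convolution hp hq hν h₁ h₂ hx
  rw [← hI, intervalIntegral.integral_of_le hx.le, integral_Ioc_eq_integral_Ioo,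
    ← integral_const_mul, ofReal_integral_eq_lintegral_ofReal]
  · refine setLIntegral_congr_fun measurableSet_Ioo fun y hy => ?_
    rw [← ENNReal.ofReal_mul (mul_nonneg ha (hp0 y hy.1))]
    congr 1
    ring
  · exact ((intervalIntegrable_iff_integrableOn_Ioo_of_le hx.le).1 hi).const_mul _
  · filter_upwards [ae_restrict_mem measurableSet_Ioo] with y hy
    have := hp0 y hy.1
    have := hq0 (x - y) (sub_pos.2 hy.2)
    positivity

/-- The densities form a convolution semigroup because exponents of (1 + lam X)^(-1) and parameters
νn both add. Extension by zero cuts the convolution down to (0, x). -/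
theorem lconvolution_eventTimeDensity {lam ν : ℝ} (hlam : 0 < lam) (hν : 0 < ν)
    [IsProbabilityMeasure (mittagLefflerLaw lam ν)] (n : ℕ) :
    lconvolution (eventTimeDensity lam ν (n + 1)) (eventTimeDensity lam ν 1) volume =
      eventTimeDensity lam ν (n + 1 + 1) := by
  funext x
  have h : ∀ y, eventTimeDensity lam ν (n + 1) y * eventTimeDensity lam ν 1 (-y + x) =
      (Set.Ioo 0 x).indicator (fun y =>
        ENNReal.ofReal (lam ^ (n + 1) *
          mlKernel ν (negBinomialSeries lam (n + 1)) (ν * (n + 1 : ℕ)) y) *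
        ENNReal.ofReal (lam * mlKernel ν (negBinomialSeries lam 1) ν (x - y))) y := fun y => by
    simp only [eventTimeDensity, Set.indicator_apply, Set.mem_Ioi, Set.mem_Ioo]
    by_cases h1 : 0 < y <;> by_cases h2 : y < x
    · have : 0 < -y + x := by linarith
      simp [h1, h2, neg_add_eq_sub]
    · have : ¬ 0 < -y + x := by linarith
      simp [h1, h2]
    · simp [h1]
    · simp [h1]
  rw [lconvolution_def]
  simp_rw [h]
  rw [lintegral_indicator measurableSet_Ioo, eventTimeDensity, Set.indicator_apply]
  split_ifs with hx
  · rw [lintegral_mlKernel_convolution (geomBounded_negBinomialSeries hlam _)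
      (geomBounded_negBinomialSeries hlam _) hν (by positivity) hν (by positivity) hlam.le hx
      (fun y hy => mlKernel_negBinomialSeries_nonneg hlam hν n hy)
      (fun y hy => mittagLeffler_density_nonneg hlam hν hy), negBinomialSeries_mul, ← pow_succ]
    congr 3
    push_cast
    ring
  · simp [Set.Ioo_eq_empty_of_le (not_lt.1 (Set.mem_Ioi.not.1 hx))]

theorem mittagLefflerLaw_Ioi {lam ν : ℝ} (hlam : 0 < lam) (hν : 0 < ν)
    [hprob : IsProbabilityMeasure (mittagLefflerLaw lam ν)] {u : ℝ} (hu : 0 < u) :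
    mittagLefflerLaw lam ν (Set.Ioi u) =
      ENNReal.ofReal (mlKernel ν (negBinomialSeries lam 1) 1 u) := by
  have hb := geomBounded_negBinomialSeries hlam 1
  obtain ⟨hi, hI⟩ := integral_mlKernel hb hν hν hu
  have h1 : mittagLefflerLaw lam ν (Set.Iic u) =
      ENNReal.ofReal (lam * mlKernel ν (negBinomialSeries lam 1) (1 + ν) u) := by
    rw [mittagLefflerLaw_eq, withDensity_apply _ measurableSet_Iic,
      Measure.restrict_restrict measurableSet_Iic, Set.Iic_inter_Ioi, add_comm 1 ν, ← hI,
      intervalIntegral.integral_of_le hu.le, ← integral_const_mul,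
      ofReal_integral_eq_lintegral_ofReal (hi.1.const_mul lam)]
    filter_upwards [ae_restrict_mem measurableSet_Ioc] with y hy
    exact mul_nonneg hlam.le (mittagLeffler_density_nonneg hlam hν hy.1)
  have h2 : 0 ≤ lam * mlKernel ν (negBinomialSeries lam 1) (1 + ν) u := by
    rw [add_comm 1 ν, ← hI]
    exact mul_nonneg hlam.le (intervalIntegral.integral_nonneg_of_ae_restrict hu.le (by
      filter_upwards [ae_restrict_mem measurableSet_Icc,
        ae_restrict_of_ae (Measure.ae_ne volume 0)] with y hy hy0
      exact mittagLeffler_density_nonneg hlam hν (lt_of_le_of_ne hy.1 hy0.symm)))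
  rw [← Set.compl_Iic, prob_compl_eq_one_sub measurableSet_Iic, h1,
    eq_sub_of_add_eq (mlKernel_negBinomialSeries_one_add hlam hν hu), ENNReal.ofReal_sub _ h2,
    ENNReal.ofReal_one]

theorem mittagLefflerLaw_ae_pos (lam ν : ℝ) : ∀ᵐ x ∂mittagLefflerLaw lam ν, 0 < x := by
  refine (withDensity_absolutelyContinuous _ _).ae_le ?_
  exact ae_restrict_mem measurableSet_Ioi

section Renewal

variable {Ω : Type*} [MeasurableSpace Ω] {P : Measure Ω}
  {lam ν : ℝ} {J : ℕ → Ω → ℝ}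

theorem hasLaw_eventTime [IsProbabilityMeasure P] (hlam : 0 < lam) (hν : 0 < ν) (hind : iIndepFun J P)
    (hmeas : ∀ n, Measurable (J n)) (hlaw : ∀ n, HasLaw (J n) (mittagLefflerLaw lam ν) P)
    (n : ℕ) :
    HasLaw (eventTime J (n + 1)) (volume.withDensity (eventTimeDensity lam ν (n + 1))) P := by
  have : IsProbabilityMeasure (mittagLefflerLaw lam ν) :=
    (hlaw 0).isProbabilityMeasure_iff.1 inferInstance
  induction n with
  | zero =>
    rw [← mittagLefflerLaw_eq_withDensity_eventTimeDensity]
    have h : eventTime J (0 + 1) = J 0 := by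
      funext ω
      simp [eventTime]
    rw [h]
    exact hlaw 0
  | succ n ih =>
    have hind' : IndepFun (eventTime J (n + 1)) (J (n + 1)) P := by
      have := hind.indepFun_sum_range_succ hmeas (n + 1)
      convert this using 1
      funext ω
      simp [eventTime]
    have : IsProbabilityMeasure (volume.withDensity (eventTimeDensity lam ν (n + 1))) :=
      ih.isProbabilityMeasure_iff.1 inferInstance
    have h := hind'.hasLaw_add ih (hlaw (n + 1))
    have hμ : volume.withDensity (eventTimeDensity lam ν (n + 1)) ∗ mittagLefflerLaw lam ν =
        volume.withDensity (eventTimeDensity lam ν (n + 1 + 1)) := by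
      rw [mittagLefflerLaw_eq_withDensity_eventTimeDensity,
        conv_withDensity_eq_lconvolution (measurable_eventTimeDensity hlam hν (by lia))
          (measurable_eventTimeDensity hlam hν le_rfl), lconvolution_eventTimeDensity hlam hν]
    rw [hμ] at h
    have hsum : eventTime J (n + 1 + 1) = eventTime J (n + 1) + J (n + 1) := by
      funext ω
      simp [eventTime, Finset.sum_range_succ]
    rw [hsum]
    exact h

theorem ae_interarrival_pos (hlaw : ∀ n, HasLaw (J n) (mittagLefflerLaw lam ν) P) :
    ∀ᵐ ω ∂P, ∀ n, 0 < J n ω := by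
  refine ae_all_iff.2 fun n => ?_
  have h := mittagLefflerLaw_ae_pos lam ν
  rw [← (hlaw n).map_eq] at h
  exact ae_of_ae_map (hlaw n).aemeasurable h

/-- The law of the number of events up to time `u`. -/
theorem measure_eventTime_le_lt [IsProbabilityMeasure P] (hlam : 0 < lam) (hν : 0 < ν) (hind : iIndepFun J P)
    (hmeas : ∀ n, Measurable (J n)) (hlaw : ∀ n, HasLaw (J n) (mittagLefflerLaw lam ν) P)
    (m : ℕ) {u : ℝ} (hu : 0 < u) :
    P {ω | eventTime J m ω ≤ u ∧ u < eventTime J m ω + J m ω} =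
      ENNReal.ofReal (lam ^ m * mlKernel ν (negBinomialSeries lam (m + 1)) (ν * m + 1) u) := by
  have : IsProbabilityMeasure (mittagLefflerLaw lam ν) :=
    (hlaw 0).isProbabilityMeasure_iff.1 inferInstance
  cases m with
  | zero =>
    have h : {ω | eventTime J 0 ω ≤ u ∧ u < eventTime J 0 ω + J 0 ω} = J 0 ⁻¹' Set.Ioi u := by
      ext ω
      simp [eventTime, hu.le]
    rw [h, ← Measure.map_apply (hmeas 0) measurableSet_Ioi, (hlaw 0).map_eq,
      mittagLefflerLaw_Ioi hlam hν hu]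
    simp
  | succ n =>
    have hind' : IndepFun (eventTime J (n + 1)) (J (n + 1)) P := by
      have := hind.indepFun_sum_range_succ hmeas (n + 1)
      convert this using 1
      funext ω
      simp [eventTime]
    have hT := hasLaw_eventTime hlam hν hind hmeas hlaw n
    have : IsProbabilityMeasure (volume.withDensity (eventTimeDensity lam ν (n + 1))) :=
      hT.isProbabilityMeasure_iff.1 inferInstance
    have hpair := hind'.hasLaw_prod hT (hlaw (n + 1))
    have hS : MeasurableSet {p : ℝ × ℝ | p.1 ≤ u ∧ u < p.1 + p.2} := by
      measurability
    have hm := hpair.measure_eq hS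
    simp only at hm
    rw [hm, Measure.prod_apply hS,
      lintegral_withDensity_eq_lintegral_mul _ (measurable_eventTimeDensity hlam hν (by lia))
        (measurable_measure_prodMk_left hS)]
    -- Given that the event time is x < u, the next interarrival time must exceed u - x: the result
    -- is the convolution of the density with the survival function. The point x = u, where the two
    -- sides may differ, is null.
    have h : ∀ x ≠ u, (eventTimeDensity lam ν (n + 1) * fun x => mittagLefflerLaw lam ν
        (Prod.mk x ⁻¹' {p : ℝ × ℝ | p.1 ≤ u ∧ u < p.1 + p.2})) x =
        (Set.Ioo 0 u).indicator (fun x =>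
          ENNReal.ofReal (lam ^ (n + 1) *
            mlKernel ν (negBinomialSeries lam (n + 1)) (ν * (n + 1 : ℕ)) x) *
          ENNReal.ofReal (1 * mlKernel ν (negBinomialSeries lam 1) 1 (u - x))) x := fun x hxu => by
      simp only [Pi.mul_apply, eventTimeDensity, Set.indicator_apply, Set.mem_Ioi, Set.mem_Ioo]
      by_cases h1 : 0 < x
      swap
      · simp [h1]
      by_cases h2 : x < u
      · have e : Prod.mk x ⁻¹' {p : ℝ × ℝ | p.1 ≤ u ∧ u < p.1 + p.2} = Set.Ioi (u - x) := by
          ext y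
          simp [h2.le, sub_lt_iff_lt_add']
        rw [e, mittagLefflerLaw_Ioi hlam hν (sub_pos.2 h2)]
        simp [h1, h2]
      · have h3 : ¬ x ≤ u := fun h => h2 (lt_of_le_of_ne h hxu)
        simp [h2, h3]
    rw [lintegral_congr_ae ((Measure.ae_ne volume u).mono h),
      lintegral_indicator measurableSet_Ioo,
      lintegral_mlKernel_convolution (geomBounded_negBinomialSeries hlam _)
      (geomBounded_negBinomialSeries hlam _) hν (by positivity) one_pos (by positivity)
      zero_le_one hu
      (fun y hy => mlKernel_negBinomialSeries_nonneg hlam hν n hy)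
      (fun y hy => survival_nonneg hlam hν hy), negBinomialSeries_mul, mul_one]

end Renewal

/-! ### Joint law, by restarting the process after the first event past s. -/

section Joint

variable {Ω : Type*} [MeasurableSpace Ω] {P : Measure Ω} {lam ν : ℝ} {J : ℕ → Ω → ℝ}

theorem measurable_eventTime (hmeas : ∀ n, Measurable (J n)) (n : ℕ) :
    Measurable (eventTime J n) :=
  Finset.measurable_fun_sum _ fun i _ => hmeas i

/-- The two sides depend on disjoint blocks of indices, below k and from k to k + 1 + m. With
indices starting at 0, `J k` is the wait between events k and k + 1. -/
theorem indepFun_eventTime (hind : iIndepFun J P) (hmeas : ∀ n, Measurable (J n)) (k m : ℕ) :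
    IndepFun (eventTime J k)
      (fun ω => (J k ω, eventTime (fun i => J (k + 1 + i)) m ω, J (k + 1 + m) ω)) P := by
  have h := hind.indepFun_finset (Finset.range k) (Finset.Ico k (k + m + 2))
    (Finset.disjoint_left.2 fun i hi hj => by
      simp only [Finset.mem_range, Finset.mem_Ico] at hi hj; lia) hmeas
  let φ : (Finset.range k → ℝ) → ℝ := fun v => ∑ i, v i
  let ψ : (Finset.Ico k (k + m + 2) → ℝ) → ℝ × ℝ × ℝ := fun v =>
    (v ⟨k, by simp; lia⟩, ∑ i : Fin m, v ⟨k + 1 + i, by have := i.2; simp; lia⟩,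
      v ⟨k + 1 + m, by simp; lia⟩)
  have hφ : Measurable φ := by fun_prop
  have hψ : Measurable ψ := by fun_prop
  have h' := h.comp hφ hψ
  have e1 : eventTime J k = φ ∘ fun ω (i : Finset.range k) => J i ω := by
    funext ω
    simp only [eventTime, Function.comp, φ]
    exact (Finset.sum_coe_sort (Finset.range k) fun i => J i ω).symm
  have e2 : (fun ω => (J k ω, eventTime (fun i => J (k + 1 + i)) m ω, J (k + 1 + m) ω)) =
      ψ ∘ fun ω (i : Finset.Ico k (k + m + 2)) => J i ω := by
    funext ω
    simp only [eventTime, Function.comp, ψ, Finset.sum_range]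
  rw [e1, e2]
  exact h'

theorem indepFun_interarrival (hind : iIndepFun J P) (hmeas : ∀ n, Measurable (J n)) (k m : ℕ) :
    IndepFun (J k) (fun ω => (eventTime (fun i => J (k + 1 + i)) m ω, J (k + 1 + m) ω)) P := by
  have h := hind.indepFun_finset {k} (Finset.Ico (k + 1) (k + m + 2))
    (by simp) hmeas
  let φ : (({k} : Finset ℕ) → ℝ) → ℝ := fun v => v ⟨k, by simp⟩
  let ψ : (Finset.Ico (k + 1) (k + m + 2) → ℝ) → ℝ × ℝ := fun v =>
    (∑ i : Fin m, v ⟨k + 1 + i, by have := i.2; simp; lia⟩, v ⟨k + 1 + m, by simp; lia⟩)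
  have hφ : Measurable φ := by fun_prop
  have hψ : Measurable ψ := by fun_prop
  have h' := h.comp hφ hψ
  have e2 : (fun ω => (eventTime (fun i => J (k + 1 + i)) m ω, J (k + 1 + m) ω)) =
      ψ ∘ fun ω (i : Finset.Ico (k + 1) (k + m + 2)) => J i ω := by
    funext ω
    simp only [eventTime, Function.comp, ψ, Finset.sum_range]
  rw [e2]
  exact h'

/-- The law of the number of events up to time `u`, extended by zero to negative times. -/
theorem measure_residual (hlam : 0 < lam) (hν : 0 < ν) [IsProbabilityMeasure P]
    (hind : iIndepFun J P) (hmeas : ∀ n, Measurable (J n))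
    (hlaw : ∀ n, HasLaw (J n) (mittagLefflerLaw lam ν) P) (m : ℕ) {u : ℝ} (hu : u ≠ 0) :
    P {ω | eventTime J m ω ≤ u ∧ u < eventTime J m ω + J m ω} =
      if 0 < u then
        ENNReal.ofReal (lam ^ m * mlKernel ν (negBinomialSeries lam (m + 1)) (ν * m + 1) u)
      else 0 := by
  split_ifs with h
  · exact measure_eventTime_le_lt hlam hν hind hmeas hlaw m h
  · have hu' : u < 0 := lt_of_le_of_ne (not_lt.1 h) hu
    refine measure_mono_null (t := {ω | ¬ ∀ n, 0 < J n ω}) (fun ω hω hpos => ?_)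
      (ae_interarrival_pos hlaw)
    have : 0 ≤ eventTime J m ω := Finset.sum_nonneg fun i _ => (hpos i).le
    linarith [hω.1]

/-- Here w is the value of T_k and y that of `J k`. The condition T_k ≤ s < T_(k+1) becomes w ≤ s
and y > s - w; the shifted interarrival times, independent of both, must give exactly m events in
time t - w - y. -/
theorem measure_event (hlam : 0 < lam) (hν : 0 < ν) [IsProbabilityMeasure P]
    (hind : iIndepFun J P) (hmeas : ∀ n, Measurable (J n))
    (hlaw : ∀ n, HasLaw (J n) (mittagLefflerLaw lam ν) P) {s t : ℝ}
    {k : ℕ} (hk : 1 ≤ k) (m : ℕ) :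
    P {ω | (eventTime J k ω ≤ s ∧ s < eventTime J (k + 1) ω) ∧
        eventTime J (k + 1 + m) ω ≤ t ∧ t < eventTime J (k + 1 + m + 1) ω} =
      ∫⁻ w in Set.Ioo 0 s,
        ENNReal.ofReal (lam ^ k * mlKernel ν (negBinomialSeries lam k) (ν * k) w) *
        ∫⁻ y in Set.Ioo (s - w) (t - w),
          ENNReal.ofReal (lam * mlKernel ν (negBinomialSeries lam 1) ν y) *
          ENNReal.ofReal (lam ^ m *
            mlKernel ν (negBinomialSeries lam (m + 1)) (ν * m + 1) (t - w - y)) := by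
  have : IsProbabilityMeasure (mittagLefflerLaw lam ν) :=
    (hlaw 0).isProbabilityMeasure_iff.1 inferInstance
  set J' : ℕ → Ω → ℝ := fun i => J (k + 1 + i) with hJ'
  have hinj : Function.Injective (fun i : ℕ => k + 1 + i) := fun i j h => by simpa using h
  have hind' : iIndepFun J' P := hind.precomp hinj
  have hmeas' : ∀ n, Measurable (J' n) := fun n => hmeas _
  have hlaw' : ∀ n, HasLaw (J' n) (mittagLefflerLaw lam ν) P := fun n => hlaw _
  set Z : Ω → ℝ × ℝ := fun ω => (eventTime J' m ω, J' m ω) with hZdef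
  have hZm : Measurable Z := (measurable_eventTime hmeas' m).prodMk (hmeas' m)
  have hZ : HasLaw Z (P.map Z) P := ⟨hZm.aemeasurable, rfl⟩
  have : IsProbabilityMeasure (P.map Z) := Measure.isProbabilityMeasure_map hZm.aemeasurable
  obtain ⟨n, rfl⟩ := Nat.exists_eq_add_of_le' hk
  have hT := hasLaw_eventTime hlam hν hind hmeas hlaw n
  have : IsProbabilityMeasure (volume.withDensity (eventTimeDensity lam ν (n + 1))) :=
    hT.isProbabilityMeasure_iff.1 inferInstance
  have hYZ := (indepFun_interarrival hind hmeas (n + 1) m).hasLaw_prod (hlaw (n + 1)) hZ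
  have hXYZ := (indepFun_eventTime hind hmeas (n + 1) m).hasLaw_prod hT hYZ
  set A : Set (ℝ × ℝ × ℝ × ℝ) := {p | (p.1 ≤ s ∧ s < p.1 + p.2.1) ∧
    p.1 + p.2.1 + p.2.2.1 ≤ t ∧ t < p.1 + p.2.1 + p.2.2.1 + p.2.2.2} with hA
  have hAm : MeasurableSet A := by measurability
  have hev : {ω | (eventTime J (n + 1) ω ≤ s ∧ s < eventTime J (n + 1 + 1) ω) ∧
        eventTime J (n + 1 + 1 + m) ω ≤ t ∧ t < eventTime J (n + 1 + 1 + m + 1) ω} =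
      {ω | (eventTime J (n + 1) ω, J (n + 1) ω, Z ω) ∈ A} := by
    ext ω
    have e1 : eventTime J (n + 1 + 1) ω = eventTime J (n + 1) ω + J (n + 1) ω :=
      Finset.sum_range_succ _ _
    have e2 : eventTime J (n + 1 + 1 + m) ω =
        eventTime J (n + 1) ω + J (n + 1) ω + eventTime J' m ω := by
      rw [← e1]
      exact Finset.sum_range_add _ _ _
    have e3 : eventTime J (n + 1 + 1 + m + 1) ω =
        eventTime J (n + 1) ω + J (n + 1) ω + eventTime J' m ω + J' m ω := by
      rw [← e2]
      exact Finset.sum_range_succ _ _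
    simp only [Set.mem_ofPred_eq, hA, hZdef, e1, e2, e3]
  have hres : ∀ w y, t - w - y ≠ 0 →
      P.map Z {z | w + y + z.1 ≤ t ∧ t < w + y + z.1 + z.2} = if 0 < t - w - y then
        ENNReal.ofReal (lam ^ m *
          mlKernel ν (negBinomialSeries lam (m + 1)) (ν * m + 1) (t - w - y)) else 0 := by
    intro w y hne
    rw [Measure.map_apply hZm (by measurability),
      ← measure_residual hlam hν hind' hmeas' hlaw' m hne]
    congr 1
    ext ω
    simp only [Set.mem_preimage, Set.mem_ofPred_eq, hZdef]
    constructor <;> rintro ⟨h1, h2⟩ <;> constructor <;> linarith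
  have hinner : ∀ w ∈ Set.Ioo 0 s,
      ((mittagLefflerLaw lam ν).prod (P.map Z)) (Prod.mk w ⁻¹' A) =
      ∫⁻ y in Set.Ioo (s - w) (t - w),
          ENNReal.ofReal (lam * mlKernel ν (negBinomialSeries lam 1) ν y) *
          ENNReal.ofReal (lam ^ m *
            mlKernel ν (negBinomialSeries lam (m + 1)) (ν * m + 1) (t - w - y)) := by
    intro w hw
    have hAw := measurable_prodMk_left (x := w) hAm
    rw [Measure.prod_apply hAw, mittagLefflerLaw_eq_withDensity_eventTimeDensity,
      lintegral_withDensity_eq_lintegral_mul _ (measurable_eventTimeDensity hlam hν le_rfl)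
        (measurable_measure_prodMk_left hAw), ← lintegral_indicator measurableSet_Ioo]
    -- The excluded null point y = t - w is where the residual time is zero, a case
    -- `measure_residual` does not cover.
    refine lintegral_congr_ae ((Measure.ae_ne volume (t - w)).mono fun y hy => ?_)
    have hne : t - w - y ≠ 0 := fun h => hy (by linarith)
    simp only [Pi.mul_apply, eventTimeDensity, Set.indicator_apply, Set.mem_Ioi, Set.mem_Ioo]
    by_cases h1 : s - w < y
    · have h0 : 0 < y := by linarith [hw.2]
      have e : Prod.mk y ⁻¹' (Prod.mk w ⁻¹' A) =
          {z | w + y + z.1 ≤ t ∧ t < w + y + z.1 + z.2} := by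
        ext z
        have : s < w + y := by linarith
        simp [hA, hw.2.le, this]
      rw [e, hres w y hne]
      by_cases h2 : y < t - w
      · simp [h0, h1, h2]
      · have : ¬ 0 < t - w - y := by linarith
        simp [h2, this]
    · have e : Prod.mk y ⁻¹' (Prod.mk w ⁻¹' A) = ∅ := by
        ext z
        have : ¬ s < w + y := by linarith
        simp [hA, this]
      simp [e, h1]
  have hPA : P {ω | (eventTime J (n + 1) ω, J (n + 1) ω, Z ω) ∈ A} =
      (volume.withDensity (eventTimeDensity lam ν (n + 1))).prod
        ((mittagLefflerLaw lam ν).prod (P.map Z)) A := by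
    rw [← hXYZ.map_eq, Measure.map_apply_of_aemeasurable hXYZ.aemeasurable hAm]
    rfl
  rw [hev, hPA, Measure.prod_apply hAm,
    lintegral_withDensity_eq_lintegral_mul _ (measurable_eventTimeDensity hlam hν hk)
        (measurable_measure_prodMk_left hAm), ← lintegral_indicator measurableSet_Ioo]
  refine lintegral_congr_ae ((Measure.ae_ne volume s).mono fun w hw => ?_)
  simp only [Pi.mul_apply, eventTimeDensity, Set.indicator_apply, Set.mem_Ioi]
  by_cases h0 : 0 < w
  swap
  · simp [h0]
  by_cases h1 : w < s
  · rw [hinner w ⟨h0, h1⟩]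
    simp [h0, h1]
  · have e : Prod.mk w ⁻¹' A = ∅ := by
      ext z
      have : ¬ w ≤ s := fun h => h1 (lt_of_le_of_ne h hw)
      simp [hA, this]
    simp [e, h1]

end Joint

/-! ### From counts to event times, and assembly of the formula. -/

/-- For positive interarrival times, the renewal count equals `k` between the `k`-th and the
`k + 1`-st event. -/
theorem encard_eventTime_le_eq_iff {Ω : Type*} {J : ℕ → Ω → ℝ} {ω : Ω} (hpos : ∀ n, 0 < J n ω)
    {t : ℝ} {k : ℕ} (hk : 1 ≤ k) :
    Set.encard {n : ℕ | 1 ≤ n ∧ eventTime J n ω ≤ t} = k ↔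
      eventTime J k ω ≤ t ∧ t < eventTime J (k + 1) ω := by
  have hmono : StrictMono fun n => eventTime J n ω := strictMono_nat_of_lt_succ fun n => by
    simp only [eventTime, Finset.sum_range_succ]
    linarith [hpos n]
  have hcard : ∀ j : ℕ, ((Finset.Icc 1 j : Finset ℕ) : Set ℕ).encard = j := fun j => by
    rw [Set.encard_coe_eq_coe_finsetCard, Nat.card_Icc, Nat.add_sub_cancel]
  constructor
  · intro h
    by_contra hcon
    rw [not_and_or, not_le, not_lt] at hcon
    rcases hcon with hcon | hcon
    · have hsub : {n : ℕ | 1 ≤ n ∧ eventTime J n ω ≤ t} ⊆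
          ((Finset.Icc 1 (k - 1) : Finset ℕ) : Set ℕ) := fun n hn => by
        have : n < k := hmono.lt_iff_lt.1 (hn.2.trans_lt hcon)
        have := hn.1
        simp only [Finset.coe_Icc, Set.mem_Icc]
        lia
      have := Set.encard_le_encard hsub
      rw [h, hcard] at this
      -- A contradiction only because k ≥ 1: with truncated subtraction it would hold at k = 0.
      have : k ≤ k - 1 := by exact_mod_cast this
      lia
    · have hsub : ((Finset.Icc 1 (k + 1) : Finset ℕ) : Set ℕ) ⊆
          {n : ℕ | 1 ≤ n ∧ eventTime J n ω ≤ t} := fun n hn => by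
        simp only [Finset.coe_Icc, Set.mem_Icc] at hn
        exact ⟨hn.1, (hmono.le_iff_le.2 hn.2).trans hcon⟩
      have := Set.encard_le_encard hsub
      rw [h, hcard] at this
      have : k + 1 ≤ k := by exact_mod_cast this
      lia
  · rintro ⟨h1, h2⟩
    have : {n : ℕ | 1 ≤ n ∧ eventTime J n ω ≤ t} = ((Finset.Icc 1 k : Finset ℕ) : Set ℕ) := by
      ext n
      simp only [Finset.coe_Icc, Set.mem_Icc, Set.mem_ofPred_eq]
      refine and_congr_right fun _ => ⟨fun h => ?_, fun h => (hmono.le_iff_le.2 h).trans h1⟩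
      exact Nat.lt_succ_iff.1 (hmono.lt_iff_lt.1 (h.trans_lt h2))
    rw [this, hcard]

theorem intervalIntegrable_mlKernel_mul {p q : PowerSeries ℝ} (hp : GeomBounded p)
    (hq : GeomBounded q) {ν η₁ η₂ a x : ℝ} (hν : 0 < ν) (h₁ : 0 < η₁) (h₂ : 0 < η₂)
    (ha : 0 ≤ a) (hax : a ≤ x) :
    IntervalIntegrable (fun y => mlKernel ν p η₁ y * mlKernel ν q η₂ (x - y)) volume a x := by
  rcases (ha.trans hax).eq_or_lt with hx | hx
  · rw [le_antisymm hax (hx ▸ ha)]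
  · refine (mlKernel_convolution hp hq hν h₁ h₂ hx).1.mono_set ?_
    rw [Set.uIcc_of_le hax, Set.uIcc_of_le hx.le]
    exact Set.Icc_subset_Icc_left ha

/-- Moving the w-dependent endpoints into an indicator gives a jointly measurable integrand over a
fixed domain, whose partial integral is measurable. -/
theorem measurable_intervalIntegral_shift {f g : ℝ → ℝ} (hf : Measurable f) (hg : Measurable g)
    {s t : ℝ} (hst : s ≤ t) :
    Measurable fun w => ∫ y in (s - w)..(t - w), f y * g (t - w - y) := by
  have h : ∀ w, ∫ y in (s - w)..(t - w), f y * g (t - w - y) =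
      ∫ y, {p : ℝ × ℝ | s - p.1 < p.2 ∧ p.2 ≤ t - p.1}.indicator
        (fun p => f p.2 * g (t - p.1 - p.2)) (w, y) := fun w => by
    rw [intervalIntegral.integral_of_le (by linarith), ← integral_indicator measurableSet_Ioc]
    rfl
  simp_rw [h]
  have hm : Measurable ({p : ℝ × ℝ | s - p.1 < p.2 ∧ p.2 ≤ t - p.1}.indicator
      fun p => f p.2 * g (t - p.1 - p.2)) := by
    refine Measurable.indicator ?_ (by measurability)
    fun_prop
  exact hm.stronglyMeasurable.integral_prod_right'.measurable

/-- `HasLaw` provides only almost everywhere measurability. Countably many modifications preserve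
independence, the laws and the almost sure counting identity. -/
theorem exists_measurable_interarrival {Ω : Type*} [MeasurableSpace Ω] {lam ν : ℝ}
    {N : ℝ → Ω → ℕ} {P : Measure Ω} (hN : IsFractionalPoissonProcess lam ν N P) :
    ∃ J : ℕ → Ω → ℝ, iIndepFun J P ∧ (∀ n, Measurable (J n)) ∧
      (∀ n, HasLaw (J n) (mittagLefflerLaw lam ν) P) ∧
      ∀ᵐ ω ∂P, ∀ t : ℝ, 0 ≤ t →
        (N t ω : ℕ∞) = Set.encard {n : ℕ | 1 ≤ n ∧ eventTime J n ω ≤ t} := by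
  obtain ⟨J, hind, hlaw, hcount⟩ := hN
  have hae : ∀ n, J n =ᵐ[P] (hlaw n).aemeasurable.mk (J n) := fun n =>
    (hlaw n).aemeasurable.ae_eq_mk
  refine ⟨fun n => (hlaw n).aemeasurable.mk (J n), hind.congr hae,
    fun n => (hlaw n).aemeasurable.measurable_mk, fun n => (hlaw n).congr (hae n).symm, ?_⟩
  filter_upwards [hcount, ae_all_iff.2 hae] with ω h1 h2 t ht
  simp only [h1 t ht, eventTime, h2]

theorem mainTheorem1 {Ω : Type*} [MeasurableSpace Ω] (P : Measure Ω) [IsProbabilityMeasure P]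
    (lam ν : ℝ) (hlam : 0 < lam) (hν0 : 0 < ν) (hν1 : ν ≤ 1)
    (N : ℝ → Ω → ℕ) (hN : IsFractionalPoissonProcess lam ν N P)
    (s t : ℝ) (hs : 0 ≤ s) (hst : s ≤ t) (k r : ℕ) (hk : 1 ≤ k) (hkr : k < r) :
    -- the inner integrals converge
    (∀ w ∈ Set.Icc 0 s, IntervalIntegrable
      (fun y : ℝ => y ^ (ν - 1) * mittagLeffler ν ν (-lam * y ^ ν) *
        (t - w - y) ^ (ν * ((r : ℝ) - k - 1)) *
        prabhakar ((r : ℝ) - k) ν (ν * ((r : ℝ) - k - 1) + 1) (-lam * (t - w - y) ^ ν))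
      volume (s - w) (t - w)) ∧
    -- the outer integral converges
    IntervalIntegrable
      (fun w : ℝ => w ^ (ν * k - 1) * prabhakar k ν (ν * k) (-lam * w ^ ν) *
        ∫ y in (s - w)..(t - w), y ^ (ν - 1) * mittagLeffler ν ν (-lam * y ^ ν) *
          (t - w - y) ^ (ν * ((r : ℝ) - k - 1)) *
          prabhakar ((r : ℝ) - k) ν (ν * ((r : ℝ) - k - 1) + 1) (-lam * (t - w - y) ^ ν))
      volume 0 s ∧
    P.real {ω | N s ω = k ∧ N t ω = r} =
      lam ^ r * ∫ w in (0 : ℝ)..s, w ^ (ν * k - 1) * prabhakar k ν (ν * k) (-lam * w ^ ν) *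
        ∫ y in (s - w)..(t - w), y ^ (ν - 1) * mittagLeffler ν ν (-lam * y ^ ν) *
          (t - w - y) ^ (ν * ((r : ℝ) - k - 1)) *
          prabhakar ((r : ℝ) - k) ν (ν * ((r : ℝ) - k - 1) + 1) (-lam * (t - w - y) ^ ν) := by
  obtain ⟨J, hind, hmeas, hlaw, hcount⟩ := exists_measurable_interarrival hN
  -- m = r - k - 1 counts the events after event k + 1, up to and including event r.
  obtain ⟨m, rfl⟩ := Nat.exists_eq_add_of_le (Nat.succ_le_of_lt hkr)
  -- The law of `J 0` under P has mass one; this is the input of all the positivity statements.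
  have hprob : IsProbabilityMeasure (mittagLefflerLaw lam ν) :=
    (hlaw 0).isProbabilityMeasure_iff.1 inferInstance
  have hk' : (0 : ℝ) < k := by exact_mod_cast hk
  have hb := fun d => geomBounded_negBinomialSeries hlam d
  have hη : 0 < ν * m + 1 := by positivity
  set f : ℝ → ℝ := mlKernel ν (negBinomialSeries lam 1) ν with hf
  set g : ℝ → ℝ := mlKernel ν (negBinomialSeries lam (m + 1)) (ν * m + 1) with hg
  set e : ℝ → ℝ := mlKernel ν (negBinomialSeries lam k) (ν * k) with he
  have hinner : ∀ w y : ℝ, y ^ (ν - 1) * mittagLeffler ν ν (-lam * y ^ ν) *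
        (t - w - y) ^ (ν * (((k.succ + m : ℕ) : ℝ) - k - 1)) *
        prabhakar (((k.succ + m : ℕ) : ℝ) - k) ν (ν * (((k.succ + m : ℕ) : ℝ) - k - 1) + 1)
          (-lam * (t - w - y) ^ ν) = f y * g (t - w - y) := fun w y => by
    have e1 : ((k.succ + m : ℕ) : ℝ) - k - 1 = m := by push_cast; ring
    have e2 : ((k.succ + m : ℕ) : ℝ) - k = (m + 1 : ℕ) := by push_cast; ring
    rw [e1, e2, rpow_mul_mittagLeffler, mul_assoc, hg, ← rpow_mul_prabhakar (Nat.le_add_left 1 m),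
      add_sub_cancel_right]
  simp only [hinner, rpow_mul_prabhakar hk, ← he]
  have hfnn : ∀ y, 0 < y → 0 ≤ f y := fun y hy => mittagLeffler_density_nonneg hlam hν0 hy
  have hgnn : ∀ y, 0 < y → 0 ≤ g y := fun y hy =>
    mlKernel_negBinomialSeries_tail_nonneg hlam hν0 m hy
  have henn : ∀ y, 0 < y → 0 ≤ e y := fun y hy => by
    obtain ⟨n, rfl⟩ := Nat.exists_eq_add_of_le' hk
    exact mlKernel_negBinomialSeries_nonneg hlam hν0 n hy
  have hint : ∀ w ∈ Set.Icc 0 s, IntervalIntegrable (fun y => f y * g (t - w - y)) volume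
      (s - w) (t - w) := fun w hw =>
    intervalIntegrable_mlKernel_mul (hb _) (hb _) hν0 hν0 hη (sub_nonneg.2 hw.2) (by linarith)
  set I : ℝ → ℝ := fun w => ∫ y in (s - w)..(t - w), f y * g (t - w - y) with hI
  have hprod : ∀ w ∈ Set.Ioo 0 s, ∀ y ∈ Set.Ioo (s - w) (t - w), 0 ≤ f y * g (t - w - y) :=
    fun w hw y hy => mul_nonneg (hfnn y (by linarith [hy.1, hw.2])) (hgnn _ (sub_pos.2 hy.2))
  have hIeq : ∀ w, I w = ∫ y in Set.Ioo (s - w) (t - w), f y * g (t - w - y) := fun w => by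
    rw [hI, ← integral_Ioc_eq_integral_Ioo, ← intervalIntegral.integral_of_le (by linarith)]
  have hInn : ∀ w ∈ Set.Ioo 0 s, 0 ≤ I w := fun w hw => by
    rw [hIeq]
    exact setIntegral_nonneg measurableSet_Ioo (hprod w hw)
  have hImeas : Measurable I := measurable_intervalIntegral_shift
    ((hb _).measurable_mlKernel hν0 hν0) ((hb _).measurable_mlKernel hν0 hη) hst
  have hImeas' : Measurable fun w => e w * I w :=
    ((hb _).measurable_mlKernel hν0 (by positivity)).mul hImeas
  have hIlint : ∀ w ∈ Set.Ioo 0 s, ∫⁻ y in Set.Ioo (s - w) (t - w),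
      ENNReal.ofReal (lam * f y) * ENNReal.ofReal (lam ^ m * g (t - w - y)) =
      ENNReal.ofReal (lam ^ (m + 1) * I w) := fun w hw => by
    rw [hIeq, ← integral_const_mul, ofReal_integral_eq_lintegral_ofReal]
    · refine setLIntegral_congr_fun measurableSet_Ioo fun y hy => ?_
      have := hfnn y (by linarith [hy.1, hw.2])
      rw [← ENNReal.ofReal_mul (by positivity)]
      congr 1
      ring
    · exact ((intervalIntegrable_iff_integrableOn_Ioo_of_le (by linarith)).1
        (hint w ⟨hw.1.le, hw.2.le⟩)).const_mul _
    · filter_upwards [ae_restrict_mem measurableSet_Ioo] with y hy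
      have := hprod w hw y hy
      positivity
  have hP : P {ω | N s ω = k ∧ N t ω = k.succ + m} =
      ∫⁻ w in Set.Ioo 0 s, ENNReal.ofReal (lam ^ (k.succ + m) * (e w * I w)) := by
    calc P {ω | N s ω = k ∧ N t ω = k.succ + m}
        = P {ω | (eventTime J k ω ≤ s ∧ s < eventTime J (k + 1) ω) ∧
            eventTime J (k + 1 + m) ω ≤ t ∧ t < eventTime J (k + 1 + m + 1) ω} := by
          refine measure_congr ?_
          filter_upwards [hcount, ae_interarrival_pos hlaw] with ω h1 h2
          refine propext (and_congr ?_ ?_)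
          · rw [← encard_eventTime_le_eq_iff h2 hk, ← h1 s hs, Nat.cast_inj]
          · rw [← encard_eventTime_le_eq_iff h2 (by lia), ← h1 t (hs.trans hst), Nat.cast_inj]
      _ = _ := by
          rw [measure_event hlam hν0 hind hmeas hlaw hk m]
          refine setLIntegral_congr_fun measurableSet_Ioo fun w hw => ?_
          have := henn w hw.1
          simp only [← hf, ← hg, ← he]
          rw [hIlint w hw, ← ENNReal.ofReal_mul (by positivity)]
          congr 1
          rw [Nat.succ_eq_add_one, add_assoc, add_comm 1 m, pow_add lam k]
          ring
  have hnn : 0 ≤ᵐ[volume.restrict (Set.Ioo 0 s)] fun w => lam ^ (k.succ + m) * (e w * I w) := by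
    filter_upwards [ae_restrict_mem measurableSet_Ioo] with w hw
    have := henn w hw.1
    have := hInn w hw
    positivity
  -- The integrand is nonnegative and its Lebesgue integral is a probability, hence finite; no
  -- estimate is needed.
  have houter : Integrable (fun w => lam ^ (k.succ + m) * (e w * I w))
      (volume.restrict (Set.Ioo 0 s)) := by
    rw [← lintegral_ofReal_ne_top_iff_integrable
      (hImeas'.const_mul _).aestronglyMeasurable hnn, ← hP]
    exact measure_ne_top _ _
  refine ⟨hint, ?_, ?_⟩
  · rw [intervalIntegrable_iff_integrableOn_Ioo_of_le hs]
    exact (integrable_const_mul_iff (isUnit_iff_ne_zero.2 (by positivity)) _).1 houter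
  · rw [intervalIntegral.integral_of_le hs, integral_Ioc_eq_integral_Ioo, ← integral_const_mul,
      integral_eq_lintegral_of_nonneg_ae hnn houter.1, ← hP]
    rfl
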